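/- Let \(p\) be an odd prime. Let \(N\) be a number field with subfields \(K\) and \(L\) such that \(N=L\cdot K\), \(L\cap K=\mathbb{Q}\), \([L:\mathbb{Q}]=p\), the degree \([N:L]\) is coprime to \(p\), and \(N/K\) is cyclic of degree \(p\). Notation. For a number field \(M\), let \(U_M\) be the unit group of its ring of integers \(\mathcal{O}_M\), \(\mathcal{I}_M\) the group of nonzero fractional ideals, \(\mathcal{P}_M\) the subgroup of principal ones, and \(\mathrm{Cl}(M)=\mathcal{I}_M/\mathcal{P}_M\). For a subfield \(F\subseteq M\), regard \(\mathcal{I}_F\) and \(\mathcal{P}_F\) as subgroups of \(\mathcal{I}_M\) via \(\mathfrak{a}\mapsto\mathfrak{a}\mathcal{O}_M\). If \([M:F]=p\), put \(\mathcal{I}_{M/F}=\{\mathfrak{A}\in\mathcal{I}_M : \mathfrak{A}^p\in\mathcal{I}_F\}\) and \(\mathcal{P}_{M/F}=\mathcal{I}_{M/F}\cap\mathcal{P}_M\). Let \(\ker(N_{N/L})\) be the kernel of the homomorphism \(\mathcal{I}_{N/K}/\mathcal{I}_K\to\mathcal{I}_{L/\mathbb{Q}}/\mathcal{I}_{\mathbb{Q}}\)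 induced by the relative norm of ideals, and let \(T_{N/K}:\mathrm{Cl}(K)\to\mathrm{Cl}(N)\) be the homomorphism induced by \(\mathfrak{a}\mapsto\mathfrak{a}\mathcal{O}_N\). Claim. The unit norm index \((U_K:N_{N/K}(U_N))\) is finite and equal to \(p^U\) for some integer \(U\ge 0\); the groups \(\mathcal{P}_{L/\mathbb{Q}}/\mathcal{P}_{\mathbb{Q}}\), \(\ker(N_{N/L})\cap\bigl((\mathcal{P}_{N/K}\mathcal{I}_K)/\mathcal{I}_K\bigr)\) and \(\ker(T_{N/K})\) are finite-dimensional vector spaces over \(\mathbb{F}_p\); and their dimensions \[A=\dim_{\mathbb{F}_p}\bigl(\mathcal{P}_{L/\mathbb{Q}}/\mathcal{P}_{\mathbb{Q}}\bigr),\quad R=\dim_{\mathbb{F}_p}\Bigl(\ker(N_{N/L})\cap\bigl((\mathcal{P}_{N/K}\mathcal{I}_K)/\mathcal{I}_K\bigr)\Bigr),\quad C=\dim_{\mathbb{F}_p}\bigl(\ker(T_{N/K})\bigr)\] satisfy the fundamental equation \(U+1=A+R+C\). -/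

import Mathlib

open NumberField Module
open scoped nonZeroDivisors

namespace DPF

/-- The group `I_K` of nonzero fractional ideals of the number field `K`. -/
abbrev FracIdeals (K : Type*) [Field K] : Type _ := (FractionalIdeal (𝓞 K)⁰ K)ˣ

/-- The extension of fractional ideals `I_K → I_N`, `𝔞 ↦ 𝔞 𝓞_N`. -/
noncomputable def extend (K N : Type*) [Field K] [Field N] [NumberField K] [NumberField N]
    [Algebra K N] : FracIdeals K →* FracIdeals N :=
  Units.map (FractionalIdeal.extendedHom (A := 𝓞 K) (K := K) N (𝓞 N)).toMonoidHom

/-- The group `I_K`, regarded as a subgroup of `I_N`. -/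
noncomputable def idealsFrom (K N : Type*) [Field K] [Field N] [NumberField K] [NumberField N]
    [Algebra K N] : Subgroup (FracIdeals N) :=
  (extend K N).range

/-- The group `P_N` of principal fractional ideals of `N`. -/
noncomputable def principal (N : Type*) [Field N] [NumberField N] : Subgroup (FracIdeals N) :=
  (toPrincipalIdeal (𝓞 N) N).range

/-- The group `P_K` of principal fractional ideals of `K`, regarded as a subgroup of `I_N`. -/
noncomputable def principalFrom (K N : Type*) [Field K] [Field N] [NumberField K] [NumberField N]
    [Algebra K N] : Subgroup (FracIdeals N) :=
  (principal K).map (extend K N)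

/-- The group `I_{N/K} = {𝔄 ∈ I_N | 𝔄 ^ p ∈ I_K}` of ambiguous ideals of `N/K`
(where `p` is the degree of `N/K`). -/
noncomputable def ambiguous (p : ℕ) (K N : Type*) [Field K] [Field N] [NumberField K]
    [NumberField N] [Algebra K N] : Subgroup (FracIdeals N) :=
  (idealsFrom K N).comap (powMonoidHom p)

/-- The group `P_{N/K} = I_{N/K} ∩ P_N` of ambiguous principal ideals of `N/K`. -/
noncomputable def ambiguousPrincipal (p : ℕ) (K N : Type*) [Field K] [Field N] [NumberField K]
    [NumberField N] [Algebra K N] : Subgroup (FracIdeals N) :=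
  ambiguous p K N ⊓ principal N

/-- The relative norm does not depend on how a fractional ideal is written as `𝔟 / d`. -/
theorem relNorm_num_mul (L N : Type*) [Field L] [Field N] [NumberField L] [NumberField N]
    [Algebra L N] (I : FractionalIdeal (𝓞 N)⁰ N) (J D : Ideal (𝓞 N))
    (h : (D : FractionalIdeal (𝓞 N)⁰ N) * I = J) :
    Ideal.relNorm (𝓞 L) I.num * Ideal.relNorm (𝓞 L) D =
      Ideal.relNorm (𝓞 L) J * Ideal.relNorm (𝓞 L) (Ideal.span {(I.den : 𝓞 N)}) := by
  rw [← map_mul, ← map_mul]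
  congr 1
  apply FractionalIdeal.coeIdeal_injective (K := N)
  simp only [FractionalIdeal.coeIdeal_mul]
  rw [← h, ← FractionalIdeal.den_mul_self_eq_num', FractionalIdeal.coeIdeal_span_singleton]
  ring

theorem relNorm_den_ne_zero (L N : Type*) [Field L] [Field N] [NumberField L] [NumberField N]
    [Algebra L N] (I : FractionalIdeal (𝓞 N)⁰ N) :
    (Ideal.relNorm (𝓞 L) (Ideal.span {(I.den : 𝓞 N)}) : FractionalIdeal (𝓞 L)⁰ L) ≠ 0 := by
  rw [FractionalIdeal.coeIdeal_ne_zero, Ne, Ideal.relNorm_eq_bot_iff,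
    Ideal.span_singleton_eq_bot]
  exact nonZeroDivisors.coe_ne_zero I.den

/-- The relative norm of fractional ideals, extending the relative norm of integral ideals
multiplicatively: it sends `𝔄 = 𝔟 / d`, where `𝔟` is integral and `d ≠ 0` is an algebraic integer,
to `N(𝔟) / N((d))`. -/
noncomputable def fracRelNorm (L N : Type*) [Field L] [Field N] [NumberField L] [NumberField N]
    [Algebra L N] : FractionalIdeal (𝓞 N)⁰ N →*₀ FractionalIdeal (𝓞 L)⁰ L where
  toFun I := (Ideal.relNorm (𝓞 L) I.num : FractionalIdeal (𝓞 L)⁰ L) /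
    (Ideal.relNorm (𝓞 L) (Ideal.span {(I.den : 𝓞 N)}) : FractionalIdeal (𝓞 L)⁰ L)
  map_zero' := by
    rw [FractionalIdeal.num_zero_eq (FaithfulSMul.algebraMap_injective (𝓞 N) N)]
    simp
  map_one' := by
    have h := relNorm_num_mul L N 1 1 1 (by simp)
    simp only [map_one, mul_one, one_mul] at h
    rw [h]
    exact div_self (relNorm_den_ne_zero L N 1)
  map_mul' I J := by
    have h := relNorm_num_mul L N (I * J) (I.num * J.num)
      (Ideal.span {(I.den : 𝓞 N)} * Ideal.span {(J.den : 𝓞 N)}) (by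
        simp only [FractionalIdeal.coeIdeal_mul, FractionalIdeal.coeIdeal_span_singleton]
        rw [← FractionalIdeal.den_mul_self_eq_num', ← FractionalIdeal.den_mul_self_eq_num']
        ring)
    rw [div_mul_div_comm, div_eq_div_iff (relNorm_den_ne_zero L N _)
      (mul_ne_zero (relNorm_den_ne_zero L N _) (relNorm_den_ne_zero L N _))]
    simp only [map_mul] at h
    simp only [← FractionalIdeal.coeIdeal_mul]
    rw [h]

/-- The relative norm `N_{N/L} : I_N → I_L`. -/
noncomputable def idealNorm (L N : Type*) [Field L] [Field N] [NumberField L] [NumberField N]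
    [Algebra L N] : FracIdeals N →* FracIdeals L :=
  Units.map (fracRelNorm L N).toMonoidHom

/-- The group `G` is elementary abelian of exponent dividing `p`, and has dimension `d` as a vector
space over the field with `p` elements. (The module structure is unique if it exists.) -/
def HasDim (p : ℕ) (G : Type*) [CommGroup G] (d : ℕ) : Prop :=
  ∃ _ : Module (ZMod p) (Additive G), Module.rank (ZMod p) (Additive G) = d

/-- The space `P_{L/F} / P_F` of absolute principal factors of `L/F`. -/
abbrev AbsFactors (p : ℕ) (F L : Type*) [Field F] [Field L] [NumberField F] [NumberField L]
    [Algebra F L] : Type _ :=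
  ambiguousPrincipal p F L ⧸ (principalFrom F L).subgroupOf (ambiguousPrincipal p F L)

/-- The kernel of the homomorphism `I_{N/K} / I_K → I_{L/F} / I_F` induced by the norm `N_{N/L}`,
as a subgroup of `I_N / I_K`: it consists of the classes of those `𝔄 ∈ I_{N/K}` for which
`N_{N/L}(𝔄)` lies in `I_F`. -/
noncomputable def normKer (p : ℕ) (F K L N : Type*) [Field F] [Field K] [Field L] [Field N]
    [NumberField F] [NumberField K] [NumberField L] [NumberField N] [Algebra F L] [Algebra K N]
    [Algebra L N] : Subgroup (FracIdeals N ⧸ idealsFrom K N) :=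
  (ambiguous p K N ⊓ (idealsFrom F L).comap (idealNorm L N)).map
    (QuotientGroup.mk' (idealsFrom K N))

/-- The space `ker(N_{N/L}) ∩ (P_{N/K} I_K / I_K)` of relative principal factors of `N/K`,
as a subgroup of `I_N / I_K`. -/
noncomputable def relFactors (p : ℕ) (F K L N : Type*) [Field F] [Field K] [Field L] [Field N]
    [NumberField F] [NumberField K] [NumberField L] [NumberField N] [Algebra F L] [Algebra K N]
    [Algebra L N] : Subgroup (FracIdeals N ⧸ idealsFrom K N) :=
  normKer p F K L N ⊓ (ambiguousPrincipal p K N).map (QuotientGroup.mk' (idealsFrom K N))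

/-- The capitulation kernel of `N/K`: the kernel of the extension homomorphism
`Cl(K) → Cl(N)` of ideal classes. -/
noncomputable def capitulationKer (K N : Type*) [Field K] [Field N] [NumberField K]
    [NumberField N] [Algebra K N] : Subgroup (ClassGroup (𝓞 K)) :=
  (ClassGroup.extendedHom (𝓞 K) (𝓞 N)).ker

/-- The group `N_{N/K}(U_N)` of relative norms of units of `N`, as a subgroup of `U_K`. -/
noncomputable def unitNorms (K N : Type*) [Field K] [Field N] [NumberField K] [NumberField N]
    [Algebra K N] : Subgroup (𝓞 K)ˣ :=
  (Units.map (RingOfIntegers.norm K : 𝓞 N →* 𝓞 K)).range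

end DPF

/-!
The extension `N / K` is cyclic of odd prime degree `p`, with generator `σ` of its Galois group.
Everything is an index computation around the ambiguous principal ideals `P_{N/K}`.

*The order of `P_{N/K} / P_K`.* A principal ideal `(x)` is ambiguous exactly when `σ x / x` is a unit
(`ambiguousPrincipal_eq_map`). By Hilbert's Theorem 90 the map `x ↦ σ x / x` therefore identifies
`P_{N/K} / P_K` with the quotient of the units of relative norm `1` by the units `σ u / u`, that is
with `H⁻¹(U_N)` (`relIndex_principalFrom`). The Herbrand quotient of a finitely generated abelian
group with an action of a group of order `p` depends only on the ranks of the group and of its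
fixed points (`herbrand_quotient`). As `p` is odd, no infinite place ramifies, and Dirichlet's
unit theorem gives `|H⁻¹(U_N)| = p · (U_K : N(U_N))`; the index `(U_K : N(U_N))` divides a power of
`p`. Hence `|P_{N/K} / P_K| = p ^ (U + 1)` (`exists_relIndex_principalFrom`).

*Splitting it.* The subgroup `(P_{N/K} ∩ I_K) / P_K` is the capitulation kernel
(`relIndex_eq_card_capitulationKer`), with quotient `P_{N/K} I_K / I_K`. The norm `N_{N/L}` maps the
latter to `I_L / I_ℚ`; its kernel is the space of relative factors. Its image is
`P_{L/ℚ} / P_ℚ`, since `L` and `K` are linearly disjoint, since `I_ℚ = P_ℚ`, and since extending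
ideals from `L` to `N` and taking the norm is raising to the power `[N : L]`, which is prime to `p`
(`card_relFactors_mul_card_absFactors`).

Identities between homomorphisms of groups of fractional ideals are checked on principal ideals
only: some power of every ideal is principal, and the groups are torsion-free
(`fracIdeals_hom_ext`).
-/

/-! ### Elementary abelian groups and the Herbrand quotient -/

/-- A finite abelian group of exponent dividing `p` has order a power of `p`. -/
theorem exists_card_eq_prime_pow {G : Type*} [CommGroup G] [Finite G] (p : ℕ) [Fact p.Prime]
    (h : ∀ g : G, g ^ p = 1) : ∃ d, Nat.card G = p ^ d :=
  IsPGroup.iff_card.1 fun g => ⟨1, by rw [pow_one, h]⟩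

theorem rank_zmod_of_card {V : Type*} [AddCommGroup V] (p : ℕ) [Fact p.Prime] [Module (ZMod p) V]
    {d : ℕ} (hd : Nat.card V = p ^ d) : Module.rank (ZMod p) V = d := by
  have hfin : Finite V := Nat.finite_of_card_ne_zero (by
    rw [hd]; exact pow_ne_zero _ (Fact.out : p.Prime).ne_zero)
  rw [← finrank_eq_rank, Nat.cast_inj]
  have h1 := Module.natCard_eq_pow_finrank (K := ZMod p) (V := V)
  rw [Nat.card_zmod] at h1
  exact Nat.pow_right_injective (Fact.out : p.Prime).two_le (h1.symm.trans hd)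

/-- For a group killed by `p`, the dimension is read off from the order. -/
theorem hasDim_of_card {G : Type*} [CommGroup G] (p : ℕ) [Fact p.Prime]
    (h : ∀ g : G, g ^ p = 1) {d : ℕ} (hd : Nat.card G = p ^ d) : DPF.HasDim p G d :=
  ⟨AddCommGroup.zmodModule fun x => h x.toMul,
    @rank_zmod_of_card (Additive G) _ p _ (AddCommGroup.zmodModule fun x => h x.toMul) d hd⟩

section Herbrand

open Polynomial

/-- The ratio of the order of the cokernel to the order of the kernel is multiplicative for
composition of endomorphisms. -/
theorem index_range_comp {M : Type*} [AddCommGroup M] (f g : Module.End ℤ M) :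
    (LinearMap.range (f * g)).toAddSubgroup.index * Nat.card (LinearMap.ker f) *
      Nat.card (LinearMap.ker g) =
    (LinearMap.range f).toAddSubgroup.index * (LinearMap.range g).toAddSubgroup.index *
      Nat.card (LinearMap.ker (f * g)) := by
  set F : M →+ M := f.toAddMonoidHom
  set G : M →+ M := g.toAddMonoidHom
  have e1 : (LinearMap.range (f * g)).toAddSubgroup = (F.comp G).range := by ext; simp [F, G]
  have e2 : (LinearMap.range f).toAddSubgroup = F.range := by ext; simp [F]
  have e3 : (LinearMap.range g).toAddSubgroup = G.range := by ext; simp [G]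
  have e4 : Nat.card (LinearMap.ker f) = Nat.card F.ker := rfl
  have e5 : Nat.card (LinearMap.ker g) = Nat.card G.ker := rfl
  have e6 : Nat.card (LinearMap.ker (f * g)) = Nat.card (F.comp G).ker := rfl
  rw [e1, e2, e3, e4, e5, e6]
  -- `[M : fgM] = [M : fM] [M : gM + ker f]`
  have h1 : (F.comp G).range.index = (G.range ⊔ F.ker).index * F.range.index := by
    rw [← AddSubgroup.index_map, AddMonoidHom.range_comp]
  -- `[M : gM] = [M : gM + ker f] [ker f : gM ∩ ker f]`
  have h2 : G.range.index = G.range.relIndex F.ker * (G.range ⊔ F.ker).index := by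
    rw [← AddSubgroup.relIndex_sup_left, AddSubgroup.relIndex_mul_index le_sup_left]
  have h3 : Nat.card F.ker = Nat.card (G.range ⊓ F.ker : AddSubgroup M) *
      G.range.relIndex F.ker := by
    rw [← AddSubgroup.relIndex_bot_left, ← AddSubgroup.relIndex_bot_left,
      ← AddSubgroup.inf_relIndex_right G.range,
      AddSubgroup.relIndex_mul_relIndex _ _ _ bot_le inf_le_right]
  have h4 : Nat.card (F.comp G).ker =
      Nat.card G.ker * Nat.card (G.range ⊓ F.ker : AddSubgroup M) := by
    have hle : G.ker ≤ (F.comp G).ker := fun x hx => by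
      simp only [AddMonoidHom.mem_ker, AddMonoidHom.comp_apply] at hx ⊢; simp [hx]
    have : (F.comp G).ker.map G = G.range ⊓ F.ker := by
      ext x
      simp only [AddSubgroup.mem_map, AddMonoidHom.mem_ker, AddMonoidHom.comp_apply,
        AddSubgroup.mem_inf, AddMonoidHom.mem_range]
      constructor
      · rintro ⟨y, hy, rfl⟩; exact ⟨⟨y, rfl⟩, hy⟩
      · rintro ⟨⟨y, rfl⟩, hy⟩; exact ⟨y, hy, rfl⟩
    rw [← this, ← AddSubgroup.relIndex_ker, ← AddSubgroup.relIndex_bot_left,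
      ← AddSubgroup.relIndex_bot_left, AddSubgroup.relIndex_mul_relIndex _ _ _ bot_le hle]
  rw [h1, h2, h3, h4]
  ring

theorem finite_ker_mul {M : Type*} [AddCommGroup M] {f g : Module.End ℤ M}
    (hf : Finite (LinearMap.ker f)) (hg : Finite (LinearMap.ker g)) :
    Finite (LinearMap.ker (f * g)) := by
  have h : LinearMap.ker (f * g) = (LinearMap.ker f).comap g := by
    ext; simp
  rw [h]
  refine Set.Finite.preimage' (f := g) (s := (LinearMap.ker f : Set M)) hf fun b _ => ?_
  by_cases hb : ∃ a, g a = b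
  · obtain ⟨a, rfl⟩ := hb
    refine Set.Finite.subset (Set.Finite.image (fun x => a + x) (s := (LinearMap.ker g : Set M)) hg)
      fun x hx => ⟨x - a, ?_, by simp⟩
    simpa [sub_eq_zero] using hx
  · convert Set.finite_empty
    ext x
    simp only [Set.mem_preimage, Set.mem_singleton_iff, Set.mem_empty_iff_false, iff_false]
    exact fun hx => hb ⟨x, hx⟩

theorem index_range_pow {M : Type*} [AddCommGroup M] (f : Module.End ℤ M)
    (hf : Finite (LinearMap.ker f)) (n : ℕ) :
    Finite (LinearMap.ker (f ^ n)) ∧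
    (LinearMap.range (f ^ n)).toAddSubgroup.index * Nat.card (LinearMap.ker f) ^ n =
    (LinearMap.range f).toAddSubgroup.index ^ n * Nat.card (LinearMap.ker (f ^ n)) := by
  induction n with
  | zero =>
    have : LinearMap.ker (f ^ 0) = ⊥ := by rw [pow_zero]; exact LinearMap.ker_id
    have h2 : (LinearMap.range (f ^ 0)).toAddSubgroup = ⊤ := by
      rw [pow_zero, show (1 : Module.End ℤ M) = LinearMap.id from rfl, LinearMap.range_id]; rfl
    rw [h2, this]
    exact ⟨inferInstance, by simp⟩
  | succ n ih =>
    obtain ⟨h0, ih⟩ := ih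
    have h := index_range_comp f (f ^ n)
    rw [← pow_succ'] at h
    refine ⟨by rw [pow_succ']; exact finite_ker_mul hf h0, ?_⟩
    apply Nat.eq_of_mul_eq_mul_right (Nat.card_pos (α := LinearMap.ker (f ^ n)))
    rw [pow_succ (Nat.card _) n]
    calc _ = ((LinearMap.range (f ^ (n+1))).toAddSubgroup.index * Nat.card (LinearMap.ker f) *
          Nat.card (LinearMap.ker (f ^ n))) * Nat.card (LinearMap.ker f) ^ n := by ring
      _ = (LinearMap.range f).toAddSubgroup.index *
          ((LinearMap.range (f ^ n)).toAddSubgroup.index * Nat.card (LinearMap.ker f) ^ n) *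
          Nat.card (LinearMap.ker (f ^ (n+1))) := by rw [h]; ring
      _ = _ := by rw [ih]; ring

/-- On a finitely generated abelian group of rank `r`, the order of the cokernel of multiplication
by `p` is `p ^ r` times the order of the kernel. -/
theorem index_range_natCast {M : Type*} [AddCommGroup M] [Module.Finite ℤ M] (p : ℕ)
    (hp : p ≠ 0) :
    Finite (LinearMap.ker (p : Module.End ℤ M)) ∧
    (LinearMap.range (p : Module.End ℤ M)).toAddSubgroup.index =
      Nat.card (LinearMap.ker (p : Module.End ℤ M)) * p ^ finrank ℤ M := by
  set T' := Submodule.torsion ℤ M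
  set T := T'.toAddSubgroup
  have memT : ∀ x : M, x ∈ T ↔ ∃ n : ℕ, n ≠ 0 ∧ n • x = 0 := fun x => by
    have : T = AddCommGroup.torsion M := Submodule.torsion_int
    rw [this]
    change IsOfFinAddOrder x ↔ _
    rw [isOfFinAddOrder_iff_nsmul_eq_zero]
    simp [Nat.pos_iff_ne_zero]
  have fT : Finite T := by
    have h1 : Module.Finite ℤ T' := inferInstance
    have : AddGroup.FG T' := Module.Finite.iff_addGroup_fg.1 h1
    refine AddCommGroup.finite_of_fg_isAddTorsion T' ?_
    exact isAddTorsion_iff_isTorsion_int.2 (Submodule.torsion_isTorsion)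
  set P : M →+ M := nsmulAddMonoidHom p
  set PT : T →+ T := nsmulAddMonoidHom p
  have e1 : (LinearMap.range (p : Module.End ℤ M)).toAddSubgroup = P.range := by ext; simp [P]
  have e2 : Nat.card (LinearMap.ker (p : Module.End ℤ M)) = Nat.card PT.ker := by
    refine Nat.card_congr ⟨fun x => ⟨⟨x, (memT _).2 ⟨p, hp, by
        have h := LinearMap.mem_ker.1 x.2
        rwa [Module.End.natCast_apply] at h⟩⟩, ?_⟩,
      fun x => ⟨x.1.1, ?_⟩, fun x => rfl, fun x => rfl⟩
    · have := x.2
      simp only [LinearMap.mem_ker, Module.End.natCast_apply] at this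
      exact Subtype.ext this
    · have := congrArg Subtype.val (AddMonoidHom.mem_ker.1 x.2)
      simpa [PT] using this
  -- the torsion part: `p M ∩ T = p T`
  have e3 : P.range.addSubgroupOf T = PT.range := by
    ext x
    simp only [AddSubgroup.mem_addSubgroupOf, AddMonoidHom.mem_range, P, PT,
      nsmulAddMonoidHom_apply]
    constructor
    · rintro ⟨y, hy⟩
      obtain ⟨n, hn, h⟩ := (memT _).1 x.2
      refine ⟨⟨y, (memT _).2 ⟨n * p, mul_ne_zero hn hp, ?_⟩⟩, Subtype.ext hy⟩
      rw [mul_nsmul', hy, h]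
    · rintro ⟨y, hy⟩; exact ⟨y, congrArg Subtype.val hy⟩
  have e4 : P.range.relIndex T = Nat.card PT.ker := by
    rw [AddSubgroup.relIndex, e3, AddSubgroup.index_range]
  -- the free part: `[M : p M + T] = [M / T : p (M / T)]`
  have e5 : (P.range ⊔ T).index = p ^ finrank ℤ M := by
    have : (P.range ⊔ T).index = (nsmulAddMonoidHom (α := M ⧸ T') p).range.index := by
      have hsurj : Function.Surjective T'.mkQ.toAddMonoidHom := T'.mkQ_surjective
      have hker : T'.mkQ.toAddMonoidHom.ker = T := by ext x; simp [T]
      have := AddSubgroup.index_comap_of_surjective (nsmulAddMonoidHom (α := M ⧸ T') p).range hsurj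
      rw [← this, ← hker, ← AddSubgroup.comap_map_eq]
      congr 2
      ext x
      simp only [AddSubgroup.mem_map, AddMonoidHom.mem_range, P, nsmulAddMonoidHom_apply]
      constructor
      · rintro ⟨_, ⟨z, rfl⟩, rfl⟩; exact ⟨T'.mkQ z, by simp⟩
      · rintro ⟨z, rfl⟩
        obtain ⟨z, rfl⟩ := T'.mkQ_surjective z
        exact ⟨_, ⟨z, rfl⟩, by simp⟩
    rw [this, AddSubgroup.index_range_nsmul, finrank_quotient_eq_of_le_torsion le_rfl]
  have fin : Finite (LinearMap.ker (p : Module.End ℤ M)) :=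
    Nat.finite_of_card_ne_zero (by rw [e2]; exact Nat.card_pos.ne')
  refine ⟨fin, ?_⟩
  rw [e1, e2, ← AddSubgroup.relIndex_mul_index (le_sup_left : P.range ≤ P.range ⊔ T),
    AddSubgroup.relIndex_sup_left, e4, e5]

/-- Modulo the `p`-th cyclotomic polynomial `1 + X + ⋯ + X ^ (p - 1)`, the elements `p` and
`(X - 1) ^ (p - 1)` of `ℤ[X]` divide each other. -/
theorem cyclotomic_sub_one_pow (p : ℕ) [Fact p.Prime] :
    (∃ u w : ℤ[X], (X - 1) ^ (p - 1) = (p : ℤ[X]) * u + (∑ i ∈ Finset.range p, X ^ i) * w) ∧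
    (∃ u w : ℤ[X], (p : ℤ[X]) = (X - 1) ^ (p - 1) * u + (∑ i ∈ Finset.range p, X ^ i) * w) := by
  have hpp : p.Prime := Fact.out
  set Φ : ℤ[X] := ∑ i ∈ Finset.range p, X ^ i with hΦ
  have h1 : ∃ v : ℤ[X], (X - 1) ^ (p - 1) = (p : ℤ[X]) * v + Φ := by
    have h : ((X - 1 : (ZMod p)[X]) ^ (p - 1)) = ∑ i ∈ Finset.range p, X ^ i := by
      have hX : (X - 1 : (ZMod p)[X]) ≠ 0 := by simpa using X_sub_C_ne_zero (1 : ZMod p)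
      apply mul_right_cancel₀ hX
      rw [geom_sum_mul, pow_sub_one_mul hpp.ne_zero, sub_pow_char, one_pow]
    have : (p : ℤ[X]) ∣ (X - 1) ^ (p - 1) - Φ := by
      rw [show (p : ℤ[X]) = C (p : ℤ) by simp, C_dvd_iff_dvd_coeff]
      intro i
      rw [← ZMod.intCast_zmod_eq_zero_iff_dvd, ← eq_intCast (Int.castRingHom (ZMod p)),
        ← coeff_map]
      simp [hΦ, Polynomial.map_sum, h]
    obtain ⟨v, hv⟩ := this
    exact ⟨v, by rw [← hv]; ring⟩
  obtain ⟨v, hv⟩ := h1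
  refine ⟨⟨v, 1, by rw [hv]; ring⟩, ?_⟩
  -- `v(1) = -1`
  have hv1 : v.eval 1 = -1 := by
    have := congrArg (eval 1) hv
    have h0 : p - 1 ≠ 0 := Nat.sub_ne_zero_of_lt hpp.one_lt
    simp only [eval_pow, eval_sub, eval_X, eval_one, sub_self, zero_pow h0, eval_add, eval_mul,
      eval_natCast, hΦ, eval_finsetSum, one_pow, Finset.sum_const, Finset.card_range,
      nsmul_eq_mul, mul_one] at this
    have hp0 : (p : ℤ) ≠ 0 := by exact_mod_cast hpp.ne_zero
    apply mul_left_cancel₀ hp0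
    linarith
  obtain ⟨w, hw⟩ : (X - 1 : ℤ[X]) ∣ v + 1 := by
    rw [show (X - 1 : ℤ[X]) = X - C (1 : ℤ) by simp, dvd_iff_isRoot]
    simp [hv1]
  -- modulo the ideal `((X - 1) ^ (p - 1), Φ)` one has `p = p (X - 1) w`
  have key : ∀ n : ℕ, ∃ a b : ℤ[X], (p : ℤ[X]) =
      (p : ℤ[X]) * ((X - 1) * w) ^ n + (X - 1) ^ (p - 1) * a + Φ * b := by
    intro n
    induction n with
    | zero => exact ⟨0, 0, by ring⟩
    | succ n ih =>
      obtain ⟨a, b, h⟩ := ih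
      refine ⟨a - ((X - 1) * w) ^ n, b + ((X - 1) * w) ^ n, ?_⟩
      have : (p : ℤ[X]) * ((X - 1) * w) =
          (p : ℤ[X]) + (X - 1 : ℤ[X]) ^ (p - 1) - Φ := by
        rw [← hw, hv]; ring
      calc (p : ℤ[X]) = _ := h
        _ = (p : ℤ[X]) * ((X - 1) * w) * ((X - 1) * w) ^ n + (X - 1) ^ (p - 1) * (a - ((X - 1) * w) ^ n)
            + Φ * (b + ((X - 1) * w) ^ n) := by rw [this]; ring
        _ = _ := by ring
  obtain ⟨a, b, h⟩ := key (p - 1)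
  refine ⟨p * w ^ (p - 1) + a, b, ?_⟩
  calc (p : ℤ[X]) = _ := h
    _ = _ := by rw [mul_pow]; ring

/-- If `1 + σ + ⋯ + σ ^ (p - 1) = 0`, then `(σ - 1) ^ (p - 1)` has the same image and kernel as
multiplication by `p`; taking `(p - 1)`-th roots gives the index of the image of `σ - 1`. -/
theorem index_range_sub_one {A : Type*} [AddCommGroup A] [Module.Finite ℤ A] (p : ℕ)
    [Fact p.Prime] (σ : Module.End ℤ A) (hσ : ∑ i ∈ Finset.range p, σ ^ i = 0)
    (hfin : Finite (LinearMap.ker (σ - 1))) (t : ℕ) (ht : finrank ℤ A = (p - 1) * t) :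
    (LinearMap.range (σ - 1)).toAddSubgroup.index = p ^ t * Nat.card (LinearMap.ker (σ - 1)) := by
  have hpp : p.Prime := Fact.out
  obtain ⟨⟨u, w, h1⟩, ⟨u', w', h2⟩⟩ := cyclotomic_sub_one_pow p
  replace h1 := congrArg (aeval σ) h1
  replace h2 := congrArg (aeval σ) h2
  simp only [map_pow, map_sub, aeval_X, map_one, map_add, map_mul, map_natCast, map_sum, hσ,
    zero_mul, add_zero] at h1 h2
  have hc : ∀ v : ℤ[X], (σ - 1) ^ (p - 1) * aeval σ v = aeval σ v * (σ - 1) ^ (p - 1) := fun v => by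
    have : (σ - 1) ^ (p - 1) = aeval σ ((X - 1) ^ (p - 1) : ℤ[X]) := by simp
    rw [this, ← map_mul, ← map_mul, mul_comm]
  have hr : LinearMap.range ((σ - 1) ^ (p - 1)) = LinearMap.range (p : Module.End ℤ A) := by
    apply le_antisymm
    · rw [h1]; exact LinearMap.range_comp_le_range _ _
    · rw [h2]; exact LinearMap.range_comp_le_range _ _
  have hk : LinearMap.ker ((σ - 1) ^ (p - 1)) = LinearMap.ker (p : Module.End ℤ A) := by
    apply le_antisymm
    · rw [h2, hc]; exact LinearMap.ker_le_ker_comp _ _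
    · rw [h1, (Nat.cast_commute p _).eq]; exact LinearMap.ker_le_ker_comp _ _
  obtain ⟨hf, h3⟩ := index_range_pow (σ - 1) hfin (p - 1)
  obtain ⟨hf', h4⟩ := index_range_natCast (M := A) p hpp.ne_zero
  rw [hr, hk, h4, ht, mul_comm (p - 1), pow_mul] at h3
  have hpos : 0 < Nat.card (LinearMap.ker (p : Module.End ℤ A)) := Nat.card_pos
  have h5 : (p ^ t * Nat.card (LinearMap.ker (σ - 1))) ^ (p - 1) =
      (LinearMap.range (σ - 1)).toAddSubgroup.index ^ (p - 1) := by
    apply Nat.eq_of_mul_eq_mul_right hpos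
    rw [← h3]; ring
  exact (Nat.pow_left_injective (Nat.sub_ne_zero_of_lt hpp.one_lt) h5).symm

/-- The Herbrand quotient of a finitely generated abelian group `M` under an automorphism `σ` with
`σ ^ p = 1`. Writing `ν = 1 + σ + ⋯ + σ ^ (p - 1)`, `b` for the rank of the fixed points of `σ` and
`b + (p - 1) t` for the rank of `M`, the orders of `ker (σ - 1) / ν M` and `ker ν / (σ - 1) M` are in
ratio `p ^ b : p ^ t`, and the former is a power of `p`. With `A = ker ν` and `B = ker (σ - 1)`, this
compares the chains `A ⊇ (σ - 1) M ⊇ (σ - 1) A` and `B ⊇ ν M ⊇ ν B = p B`, whose lower steps are both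
isomorphic to `M / (A + B)`. -/
theorem herbrand_quotient {M : Type*} [AddCommGroup M] [Module.Finite ℤ M] (p : ℕ) [Fact p.Prime]
    (σ : Module.End ℤ M) (hσ : σ ^ p = 1) (t : ℕ)
    (ht : finrank ℤ M = (p - 1) * t + finrank ℤ (LinearMap.ker (σ - 1))) :
    (LinearMap.range (∑ i ∈ Finset.range p, σ ^ i)).toAddSubgroup.relIndex
        (LinearMap.ker (σ - 1)).toAddSubgroup * p ^ t =
      (LinearMap.range (σ - 1)).toAddSubgroup.relIndex
        (LinearMap.ker (∑ i ∈ Finset.range p, σ ^ i)).toAddSubgroup *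
        p ^ finrank ℤ (LinearMap.ker (σ - 1)) ∧
    ∃ U : ℕ, (LinearMap.range (∑ i ∈ Finset.range p, σ ^ i)).toAddSubgroup.relIndex
        (LinearMap.ker (σ - 1)).toAddSubgroup = p ^ U := by
  have hpp : p.Prime := Fact.out
  set ν : Module.End ℤ M := ∑ i ∈ Finset.range p, σ ^ i with hν
  set δ := σ - 1 with hδ
  have hνδ : ν * δ = 0 := by rw [hν, hδ, geom_sum_mul, hσ, sub_self]
  have hδν : δ * ν = 0 := by rw [hν, hδ, mul_geom_sum, hσ, sub_self]
  set A := LinearMap.ker ν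
  set B := LinearMap.ker δ
  have hσB : ∀ x ∈ B, σ x = x := fun x hx => by
    simpa [B, hδ, sub_eq_zero] using hx
  have hνB : ∀ x ∈ B, ν x = p • x := fun x hx => by
    have : ∀ i : ℕ, (σ ^ i) x = x := fun i => by
      induction i with
      | zero => simp
      | succ i ih => rw [pow_succ, Module.End.mul_apply, hσB x hx, ih]
    simp [hν, this]
  have hσA : ∀ x ∈ A, σ x ∈ A := fun x hx => by
    have : ν * σ = σ * ν := by
      have : σ = δ + 1 := by simp [hδ]
      rw [this, mul_add, add_mul, hνδ, hδν]; simp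
    simp only [A, LinearMap.mem_ker] at hx ⊢
    rw [← Module.End.mul_apply, this, Module.End.mul_apply, hx, map_zero]
  obtain ⟨hfinB, hB⟩ := index_range_natCast (M := B) p hpp.ne_zero
  set σA : Module.End ℤ A := σ.restrict hσA
  have hpow : ∀ (i : ℕ) (x : A), ((σA ^ i) x : M) = (σ ^ i) x := fun i x => by
    induction i generalizing x with
    | zero => simp
    | succ i ih => rw [pow_succ, pow_succ, Module.End.mul_apply, Module.End.mul_apply, ih]; rfl
  have hsum : ∑ i ∈ Finset.range p, σA ^ i = 0 := by
    ext x
    have := x.2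
    simp only [A, LinearMap.mem_ker, hν, LinearMap.sum_apply] at this
    simp only [LinearMap.sum_apply, Submodule.coe_sum, hpow, this, LinearMap.zero_apply,
      Submodule.coe_zero]
  have hδA : ∀ x : A, ((σA - 1) x : M) = δ x := fun x => rfl
  -- `ν` is multiplication by `p` on `B`, so `A ∩ B` is the `p`-torsion of `B`
  let e : LinearMap.ker (σA - 1) ≃ LinearMap.ker (p : Module.End ℤ B) :=
    { toFun := fun x => ⟨⟨x.1.1, by
          have := congrArg Subtype.val (LinearMap.mem_ker.1 x.2)
          rwa [hδA] at this⟩, by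
        have h := x.1.2
        have hb : x.1.1 ∈ B := by
          have := congrArg Subtype.val (LinearMap.mem_ker.1 x.2)
          rwa [hδA] at this
        rw [LinearMap.mem_ker, hνB _ hb] at h
        rw [LinearMap.mem_ker, Module.End.natCast_apply]
        exact Subtype.ext h⟩
      invFun := fun x => ⟨⟨x.1.1, by
          have h := congrArg Subtype.val (LinearMap.mem_ker.1 x.2)
          rw [Module.End.natCast_apply] at h
          rw [LinearMap.mem_ker, hνB _ x.1.2]
          exact h⟩, by
        rw [LinearMap.mem_ker]
        exact Subtype.ext x.1.2⟩
      left_inv := fun x => rfl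
      right_inv := fun x => rfl }
  -- the image of `ν` lies between `p B` and `B`, so it has the rank of `B`
  have hrkA : finrank ℤ A = (p - 1) * t := by
    have h1 : finrank ℤ (M ⧸ A) + finrank ℤ A = finrank ℤ M := A.finrank_quotient_add_finrank
    rw [ν.quotKerEquivRange.finrank_eq] at h1
    have h2 : finrank ℤ (LinearMap.range ν) = finrank ℤ B := by
      apply le_antisymm
      · refine Submodule.finrank_mono ?_
        rintro _ ⟨y, rfl⟩
        rw [LinearMap.mem_ker, ← Module.End.mul_apply, hδν]; rfl
      · have h3 := (LinearMap.ker (p : Module.End ℤ B)).finrank_quotient_add_finrank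
        have h4 : finrank ℤ (LinearMap.ker (p : Module.End ℤ B)) = 0 :=
          Module.finrank_eq_zero_iff_isTorsion.2
            (isAddTorsion_iff_isTorsion_int.1 isAddTorsion_of_finite)
        rw [h4, add_zero,
          (LinearMap.quotKerEquivRange _).finrank_eq,
          (Submodule.equivMapOfInjective B.subtype B.injective_subtype _).finrank_eq] at h3
        rw [← h3]
        refine Submodule.finrank_mono ?_
        rintro _ ⟨_, ⟨y, rfl⟩, rfl⟩
        exact ⟨y, by rw [hνB _ y.2]; simp⟩
    omega
  have hA := index_range_sub_one p σA hsum (Finite.of_equiv _ e.symm) t hrkA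
  rw [Nat.card_congr e] at hA
  set D : M →+ M := δ.toAddMonoidHom
  set V : M →+ M := ν.toAddMonoidHom
  have eA : A.toAddSubgroup = V.ker := by ext; simp [A, V]
  have eB : B.toAddSubgroup = D.ker := by ext; simp [B, D]
  have eV : (LinearMap.range ν).toAddSubgroup = (⊤ : AddSubgroup M).map V := by ext; simp [V]
  have eD : (LinearMap.range δ).toAddSubgroup = (⊤ : AddSubgroup M).map D := by ext; simp [D]
  have i1 : (LinearMap.range (σA - 1)).toAddSubgroup.index =
      (V.ker.map D).relIndex V.ker := by
    rw [AddSubgroup.relIndex]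
    congr 1
    ext x
    simp only [Submodule.mem_toAddSubgroup, LinearMap.mem_range]
    constructor
    · rintro ⟨y, rfl⟩; exact ⟨y, y.2, rfl⟩
    · rintro ⟨y, hy, h⟩; exact ⟨⟨y, hy⟩, Subtype.ext h⟩
  have i2 : (LinearMap.range (p : Module.End ℤ B)).toAddSubgroup.index =
      (D.ker.map V).relIndex D.ker := by
    rw [AddSubgroup.relIndex]
    congr 1
    ext x
    simp only [Submodule.mem_toAddSubgroup, LinearMap.mem_range]
    constructor
    · rintro ⟨y, rfl⟩; exact ⟨y, y.2, hνB y y.2⟩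
    · rintro ⟨y, hy, h⟩; exact ⟨⟨y, hy⟩, Subtype.ext ((hνB y hy).symm.trans h)⟩
  have j1 := AddSubgroup.relIndex_map_map D V.ker ⊤
  have j2 := AddSubgroup.relIndex_map_map V D.ker ⊤
  rw [top_sup_eq] at j1 j2
  rw [sup_comm, ← j1] at j2
  have k1 : (V.ker.map D).relIndex V.ker = _ := (AddSubgroup.relIndex_mul_relIndex (V.ker.map D)
    ((⊤ : AddSubgroup M).map D) V.ker (AddSubgroup.map_mono le_top) (by
      rintro _ ⟨y, -, rfl⟩
      exact congrArg (fun f : Module.End ℤ M => f y) hνδ)).symm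
  have k2 : (D.ker.map V).relIndex D.ker = _ := (AddSubgroup.relIndex_mul_relIndex (D.ker.map V)
    ((⊤ : AddSubgroup M).map V) D.ker (AddSubgroup.map_mono le_top) (by
      rintro _ ⟨y, -, rfl⟩
      exact congrArg (fun f : Module.End ℤ M => f y) hδν)).symm
  rw [eA, eB, eV, eD]
  rw [i1, k1] at hA
  rw [i2, k2, j2] at hB
  have hpos : 0 < Nat.card (LinearMap.ker (p : Module.End ℤ B)) := Nat.card_pos
  have hne : 0 < ((V.ker.map D).relIndex ((⊤ : AddSubgroup M).map D)) := by
    rw [Nat.pos_iff_ne_zero]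
    intro h0
    rw [h0, zero_mul, zero_eq_mul] at hA
    rcases hA with h | h
    · exact pow_ne_zero _ hpp.ne_zero h
    · exact hpos.ne' h
  obtain ⟨k, hk⟩ : ∃ k, Nat.card (LinearMap.ker (p : Module.End ℤ B)) = p ^ k := by
    refine exists_card_eq_prime_pow (G := Multiplicative (LinearMap.ker (p : Module.End ℤ B))) p
      fun g => ?_
    have h := LinearMap.mem_ker.1 g.toAdd.2
    rw [Module.End.natCast_apply] at h
    exact Subtype.ext h
  refine ⟨?_, ?_⟩
  swap
  · rw [hk, ← pow_add] at hB
    obtain ⟨U, -, hU⟩ := (Nat.dvd_prime_pow hpp).1 (Dvd.intro_left _ hB)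
    exact ⟨U, hU⟩
  apply Nat.eq_of_mul_eq_mul_left hne
  rw [← mul_assoc, ← mul_assoc, hB, hA]
  ring

end Herbrand

/-! ### Units in cyclic extensions -/

section Units

variable {K N : Type*} [Field K] [Field N] [NumberField K] [NumberField N] [Algebra K N]

theorem algebraMap_norm_eq_prod_range {p : ℕ} [IsGalois K N] (hNK : finrank K N = p)
    {σ : Gal(N/K)} (hσ : ∀ τ, τ ∈ Subgroup.zpowers σ) (x : N) :
    algebraMap K N (Algebra.norm K x) = ∏ i ∈ Finset.range p, (σ ^ i) x := by
  classical
  have ho : orderOf σ = p := by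
    rw [orderOf_eq_card_of_forall_mem_zpowers hσ, IsGalois.card_aut_eq_finrank, hNK]
  rw [Algebra.norm_eq_prod_automorphisms, ← IsCyclic.image_range_orderOf hσ, ho,
    Finset.prod_image]
  intro i hi j hj h
  rw [← ho] at hi hj
  exact pow_injOn_Iio_orderOf (by simpa using hi) (by simpa using hj) h

variable (K N) in
/-- No infinite place of `K` ramifies in `N`, because the degree is odd. -/
theorem rank_units_cyclic {p : ℕ} (hp : Odd p) [IsGalois K N] (hNK : finrank K N = p) :
    Units.rank N = (p - 1) * Fintype.card (InfinitePlace K) + Units.rank K := by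
  have h1 : Odd (finrank K N) := hNK ▸ hp
  have := IsUnramifiedAtInfinitePlaces_of_odd_finrank (k := K) (K := N) h1
  have h2 := IsUnramifiedAtInfinitePlaces.card_infinitePlace K N
  rw [hNK] at h2
  obtain ⟨q, rfl⟩ : ∃ q, p = q + 1 := ⟨p - 1, by have := hp.pos; omega⟩
  have hK : 0 < Fintype.card (InfinitePlace K) := Fintype.card_pos
  simp only [Units.rank, h2, Nat.add_sub_cancel]
  rw [mul_comm, add_mul, one_mul, ← Nat.add_sub_assoc hK]

/-- The inclusion of the unit group of `𝓞 N` into `Nˣ`. -/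
noncomputable def unitsIncl (N : Type*) [Field N] : (𝓞 N)ˣ →* Nˣ :=
  Units.map (algebraMap (𝓞 N) N : 𝓞 N →* N)

theorem unitsIncl_injective (N : Type*) [Field N] : Function.Injective (unitsIncl N) :=
  Units.map_injective (RingOfIntegers.coe_injective)

omit [NumberField N] in
theorem mem_range_unitsIncl_of_isIntegral {x : Nˣ} (h : IsIntegral ℤ (x : N))
    (h' : IsIntegral ℤ ((x⁻¹ : Nˣ) : N)) : x ∈ (unitsIncl N).range :=
  ⟨⟨⟨x, h⟩, ⟨_, h'⟩, RingOfIntegers.ext (x.mul_inv), RingOfIntegers.ext (x.inv_mul)⟩, Units.ext rfl⟩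

theorem isIntegral_of_spanSingleton_le_one {x : N}
    (h : FractionalIdeal.spanSingleton (𝓞 N)⁰ x ≤ 1) : IsIntegral ℤ x := by
  rw [FractionalIdeal.spanSingleton_le_iff_mem, FractionalIdeal.mem_one_iff] at h
  obtain ⟨y, rfl⟩ := h
  exact y.2

variable (N) in
theorem range_unitsIncl : (unitsIncl N).range = (toPrincipalIdeal (𝓞 N) N).ker := by
  have key : ∀ u : (𝓞 N)ˣ,
      FractionalIdeal.spanSingleton (𝓞 N)⁰ ((unitsIncl N u : Nˣ) : N) ≤ 1 := fun u => by
    rw [FractionalIdeal.spanSingleton_le_iff_mem, FractionalIdeal.mem_one_iff]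
    exact ⟨u, rfl⟩
  ext x
  constructor
  · rintro ⟨u, rfl⟩
    rw [MonoidHom.mem_ker, toPrincipalIdeal_eq_iff, Units.val_one]
    refine le_antisymm (key u) ?_
    have h := mul_le_mul_right (key u⁻¹) (FractionalIdeal.spanSingleton (𝓞 N)⁰
      ((unitsIncl N u : Nˣ) : N))
    rwa [FractionalIdeal.spanSingleton_mul_spanSingleton, map_inv, Units.mul_inv,
      FractionalIdeal.spanSingleton_one, mul_one] at h
  · intro hx
    have hx' := (Subgroup.inv_mem_iff _).2 hx
    rw [MonoidHom.mem_ker, toPrincipalIdeal_eq_iff, Units.val_one] at hx hx'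
    exact mem_range_unitsIncl_of_isIntegral (isIntegral_of_spanSingleton_le_one hx.le)
      (isIntegral_of_spanSingleton_le_one hx'.le)

/-- The map `x ↦ σ x / x`. -/
noncomputable def coboundary (σ : Gal(N/K)) : Nˣ →* Nˣ :=
  Units.map (σ : N →* N) / MonoidHom.id Nˣ

/-- The relative norm `Nˣ → Kˣ`. -/
noncomputable def unitsNorm (K N : Type*) [Field K] [Field N] [Algebra K N] : Nˣ →* Kˣ :=
  Units.map (Algebra.norm K)

theorem mem_range_algebraMap_of_generator [IsGalois K N] {σ : Gal(N/K)}
    (hσ : ∀ τ, τ ∈ Subgroup.zpowers σ) {x : N} (hx : σ x = x) :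
    x ∈ Set.range (algebraMap K N) := by
  rw [IsGalois.mem_range_algebraMap_iff_fixed]
  have h : Subgroup.zpowers σ ≤ MulAction.stabilizer Gal(N/K) x := by
    rw [Subgroup.zpowers_le]; exact hx
  exact fun τ => h (hσ τ)

/-- The index of the norms in the units of `K` is a power of `p`, and the units of norm `1` modulo
the units `σ u / u` form a group `p` times as large. -/
theorem exists_index_unitNorms {p : ℕ} [Fact p.Prime] (hp : Odd p) [IsGalois K N]
    (hNK : finrank K N = p) {σ : Gal(N/K)} (hσ : ∀ τ, τ ∈ Subgroup.zpowers σ) :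
    ∃ U : ℕ, (DPF.unitNorms K N).index = p ^ U ∧
      ((toPrincipalIdeal (𝓞 N) N).ker.map (coboundary σ)).relIndex
        ((toPrincipalIdeal (𝓞 N) N).ker ⊓ (unitsNorm K N).ker) = p ^ (U + 1) := by
  have hpp : p.Prime := Fact.out
  rw [← range_unitsIncl]
  let s : (𝓞 N)ˣ →* (𝓞 N)ˣ :=
    Units.map (RingOfIntegers.mapRingEquiv (σ : N ≃+* N) : 𝓞 N →* 𝓞 N)
  let κ : (𝓞 K)ˣ →* (𝓞 N)ˣ := Units.map (algebraMap (𝓞 K) (𝓞 N) : 𝓞 K →* 𝓞 N)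
  have hκi : Function.Injective κ := Units.map_injective (FaithfulSMul.algebraMap_injective _ _)
  let S : Module.End ℤ (Additive (𝓞 N)ˣ) := (MonoidHom.toAdditive s).toIntLinearMap
  have hval : ∀ u : (𝓞 N)ˣ, (unitsIncl N (s u) : N) = σ (unitsIncl N u : N) := fun u => rfl
  have hval' : ∀ (i : ℕ) (u : (𝓞 N)ˣ),
      (unitsIncl N ((S ^ i) (Additive.ofMul u)).toMul : N) = (σ ^ i) (unitsIncl N u : N) := by
    intro i
    induction i with
    | zero => intro u; rfl
    | succ i ih =>
      intro u
      rw [pow_succ, Module.End.mul_apply, pow_succ, AlgEquiv.mul_apply]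
      exact ih (s u)
  have inj : ∀ {u v : (𝓞 N)ˣ}, (unitsIncl N u : N) = (unitsIncl N v : N) → u = v :=
    fun h => unitsIncl_injective N (Units.ext h)
  have ho : orderOf σ = p := by
    rw [orderOf_eq_card_of_forall_mem_zpowers hσ, IsGalois.card_aut_eq_finrank, hNK]
  have hSp : S ^ p = 1 := by
    refine LinearMap.ext fun u => ?_
    have h : ((S ^ p) (Additive.ofMul u.toMul)).toMul = u.toMul :=
      inj (by rw [hval', ← ho, pow_orderOf_eq_one]; rfl)
    exact h
  -- the fixed units are the units of `K`
  have hker : (LinearMap.ker (S - 1)).toAddSubgroup = Subgroup.toAddSubgroup κ.range := by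
    ext u
    have h1 : u ∈ (LinearMap.ker (S - 1)).toAddSubgroup ↔ s u.toMul = u.toMul := by
      rw [Submodule.mem_toAddSubgroup, LinearMap.mem_ker, LinearMap.sub_apply, sub_eq_zero]; rfl
    have h2 : u ∈ Subgroup.toAddSubgroup κ.range ↔ u.toMul ∈ κ.range := Iff.rfl
    rw [h1, h2]
    constructor
    · intro h
      obtain ⟨y, hy⟩ := mem_range_algebraMap_of_generator hσ
        (x := (unitsIncl N u.toMul : N)) (by rw [← hval, h])
      have hy0 : y ≠ 0 := by rintro rfl; exact (unitsIncl N u.toMul).ne_zero (by rw [← hy, map_zero])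
      have hi : (algebraMap K N y⁻¹) = (unitsIncl N u.toMul⁻¹ : N) := by
        rw [map_inv₀, hy, map_inv, Units.val_inv_eq_inv_val]
      obtain ⟨v, hv⟩ := mem_range_unitsIncl_of_isIntegral (x := Units.mk0 y hy0)
        ((isIntegral_algebraMap_iff (algebraMap K N).injective).1
          (by rw [Units.val_mk0, hy]; exact (u.toMul : 𝓞 N).2))
        ((isIntegral_algebraMap_iff (algebraMap K N).injective).1
          (by rw [Units.val_inv_eq_inv_val, Units.val_mk0, hi]; exact (u.toMul⁻¹ : (𝓞 N)ˣ).1.2))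
      exact ⟨v, inj (by rw [← hy]; exact congrArg (algebraMap K N) (congrArg Units.val hv))⟩
    · rintro ⟨v, hv⟩
      rw [← hv]
      exact inj ((hval _).trans (σ.commutes _))
  have hrk : finrank ℤ (LinearMap.ker (S - 1)) = Units.rank K := by
    let k : Additive (𝓞 K)ˣ →ₗ[ℤ] Additive (𝓞 N)ˣ := (MonoidHom.toAdditive κ).toIntLinearMap
    have hk : LinearMap.range k = LinearMap.ker (S - 1) :=
      Submodule.toAddSubgroup_injective (by rw [hker]; rfl)
    rw [← hk, LinearMap.finrank_range_of_inj hκi, Units.finrank_eq]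
  have hν : ∀ u : (𝓞 N)ˣ, ((∑ i ∈ Finset.range p, S ^ i) (Additive.ofMul u)).toMul =
      κ (Units.map (RingOfIntegers.norm K : 𝓞 N →* 𝓞 K) u) := fun u => by
    apply inj
    rw [LinearMap.sum_apply, toMul_sum, map_prod, Units.coe_prod]
    simp only [hval']
    exact (algebraMap_norm_eq_prod_range hNK hσ _).symm
  have hrangeν : (LinearMap.range (∑ i ∈ Finset.range p, S ^ i)).toAddSubgroup =
      Subgroup.toAddSubgroup ((DPF.unitNorms K N).map κ) := by
    ext u
    constructor
    · rintro ⟨v, rfl⟩; exact ⟨_, ⟨v.toMul, rfl⟩, (hν v.toMul).symm⟩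
    · rintro ⟨_, ⟨v, rfl⟩, hv⟩; exact ⟨Additive.ofMul v, (hν v).trans hv⟩
  have hkerν : (LinearMap.ker (∑ i ∈ Finset.range p, S ^ i)).toAddSubgroup =
      Subgroup.toAddSubgroup ((unitsNorm K N).ker.comap (unitsIncl N)) := by
    ext u
    have h1 : u ∈ (LinearMap.ker (∑ i ∈ Finset.range p, S ^ i)).toAddSubgroup ↔
        κ (Units.map (RingOfIntegers.norm K : 𝓞 N →* 𝓞 K) u.toMul) = 1 := by
      rw [← hν]; rfl
    have h2 : u ∈ Subgroup.toAddSubgroup ((unitsNorm K N).ker.comap (unitsIncl N)) ↔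
        unitsNorm K N (unitsIncl N u.toMul) = 1 := Iff.rfl
    rw [h1, h2, map_eq_one_iff κ hκi, ← map_eq_one_iff _ (unitsIncl_injective K)]
    rfl
  have hrangeδ : (LinearMap.range (S - 1)).toAddSubgroup =
      Subgroup.toAddSubgroup (s / MonoidHom.id _).range := rfl
  obtain ⟨h1, U, h2⟩ := herbrand_quotient p S hSp (Fintype.card (InfinitePlace K)) (by
    rw [hrk, Units.finrank_eq]
    exact rank_units_cyclic K N hp hNK)
  rw [hker, hkerν, hrangeν, hrangeδ, hrk, Subgroup.relIndex_toAddSubgroup,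
    Subgroup.relIndex_toAddSubgroup] at h1
  rw [hker, hrangeν, Subgroup.relIndex_toAddSubgroup] at h2
  have h3 : (DPF.unitNorms K N).index = p ^ U := by
    rw [← h2, MonoidHom.range_eq_map, Subgroup.relIndex_map_map_of_injective _ _ hκi,
      Subgroup.relIndex_top_right]
  refine ⟨U, h3, ?_⟩
  have h4 : (unitsIncl N).range.map (coboundary σ) =
      ((s / MonoidHom.id _).range).map (unitsIncl N) := by
    rw [MonoidHom.map_range, MonoidHom.map_range]
    congr 1
  have h5 : (unitsIncl N).range ⊓ (unitsNorm K N).ker =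
      ((unitsNorm K N).ker.comap (unitsIncl N)).map (unitsIncl N) := by
    rw [Subgroup.map_comap_eq]
  rw [h4, h5, Subgroup.relIndex_map_map_of_injective _ _ (unitsIncl_injective N)]
  rw [h2] at h1
  apply Nat.eq_of_mul_eq_mul_right (pow_pos hpp.pos (Units.rank K))
  rw [← h1, pow_succ, mul_assoc, ← pow_succ']
  congr 2
  have hK : 0 < Fintype.card (InfinitePlace K) := Fintype.card_pos
  simp only [Units.rank]
  omega

end Units

/-! ### Extension and norm of fractional ideals -/

section Ideals

variable {K N : Type*} [Field K] [Field N] [NumberField K] [NumberField N] [Algebra K N]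

omit [NumberField K] in
theorem fracIdeals_le_one_of_pow_eq_one {n : ℕ} (hn : n ≠ 0) {I : DPF.FracIdeals K}
    (h : I ^ n = 1) : (I : FractionalIdeal (𝓞 K)⁰ K) ≤ 1 := by
  intro x hx
  have h1 : x ^ n ∈ ((I : FractionalIdeal (𝓞 K)⁰ K) ^ n : FractionalIdeal (𝓞 K)⁰ K) := by
    rw [← FractionalIdeal.mem_coe, FractionalIdeal.coe_pow]
    exact Submodule.pow_mem_pow _ hx n
  rw [← Units.val_pow_eq_pow_val, h, Units.val_one, FractionalIdeal.mem_one_iff] at h1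
  obtain ⟨y, hy⟩ := h1
  have h2 : IsIntegral ℤ x := IsIntegral.of_pow (Nat.pos_of_ne_zero hn) (by
    rw [← hy]; exact y.2)
  exact (FractionalIdeal.mem_one_iff _).2 ⟨⟨x, h2⟩, rfl⟩

/-- The group of fractional ideals is torsion-free: an ideal with a trivial power consists of integral
elements, and so does its inverse. -/
theorem fracIdeals_pow_injective {n : ℕ} (hn : n ≠ 0) :
    Function.Injective fun I : DPF.FracIdeals K => I ^ n := by
  intro I J h
  have h1 : (I / J) ^ n = 1 := by rw [div_pow, div_eq_one]; exact h
  have h2 := fracIdeals_le_one_of_pow_eq_one hn h1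
  have h3 := fracIdeals_le_one_of_pow_eq_one (I := (I / J)⁻¹) hn (by rw [inv_pow, h1, inv_one])
  rw [← div_eq_one]
  refine Units.ext (le_antisymm h2 ?_)
  have h := mul_le_mul_right h3 ((I / J : DPF.FracIdeals K) : FractionalIdeal (𝓞 K)⁰ K)
  rwa [Units.mul_inv, mul_one] at h

theorem classGroup_mk_ker :
    (ClassGroup.mk K : DPF.FracIdeals K →* ClassGroup (𝓞 K)).ker = DPF.principal K := by
  ext I
  rw [MonoidHom.mem_ker, ClassGroup.mk_eq_one_iff, DPF.principal, mem_principal_ideals_iff]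
  constructor
  · rintro ⟨x, hx⟩
    refine ⟨x, ?_⟩
    rw [← FractionalIdeal.coeToSubmodule_inj, FractionalIdeal.coe_spanSingleton, hx]
  · rintro ⟨x, hx⟩
    exact ⟨x, by rw [← hx, FractionalIdeal.coe_spanSingleton]⟩

variable (K) in
theorem exists_pow_mem_principal :
    ∃ h : ℕ, h ≠ 0 ∧ ∀ I : DPF.FracIdeals K, I ^ h ∈ DPF.principal K :=
  ⟨Fintype.card (ClassGroup (𝓞 K)), Fintype.card_ne_zero, fun I => by
    rw [← classGroup_mk_ker, MonoidHom.mem_ker, map_pow, pow_card_eq_one]⟩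

omit [Algebra K N] in
/-- Two homomorphisms from fractional ideals into fractional ideals that agree on principal ideals
are equal. -/
theorem fracIdeals_hom_ext {f g : DPF.FracIdeals K →* DPF.FracIdeals N}
    (h : ∀ x : Kˣ, f (toPrincipalIdeal (𝓞 K) K x) = g (toPrincipalIdeal (𝓞 K) K x)) : f = g := by
  obtain ⟨n, hn, hp⟩ := exists_pow_mem_principal K
  ext1 I
  obtain ⟨x, hx⟩ := hp I
  apply fracIdeals_pow_injective hn
  simp only
  rw [← map_pow, ← map_pow, ← hx, h]

theorem extend_toPrincipalIdeal (x : Kˣ) :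
    DPF.extend K N (toPrincipalIdeal (𝓞 K) K x) =
      toPrincipalIdeal (𝓞 N) N (Units.map (algebraMap K N : K →* N) x) := by
  symm
  rw [toPrincipalIdeal_eq_iff]
  have := FractionalIdeal.extendedHom_spanSingleton (A := 𝓞 K) (K := K) N (𝓞 N) (x : K)
  change _ = FractionalIdeal.extendedHom (A := 𝓞 K) (K := K) N (𝓞 N)
    (toPrincipalIdeal (𝓞 K) K x : FractionalIdeal (𝓞 K)⁰ K)
  rw [coe_toPrincipalIdeal, this]
  rw [IsLocalization.algebraMap_eq_map_map_submonoid (𝓞 K)⁰ (𝓞 N) K N]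
  rfl

theorem extend_injective : Function.Injective (DPF.extend K N) :=
  Units.map_injective (FractionalIdeal.extendedHom_injective (A := 𝓞 K) (K := K) N (𝓞 N))

theorem fracRelNorm_coeIdeal (J : Ideal (𝓞 N)) :
    DPF.fracRelNorm K N (J : FractionalIdeal (𝓞 N)⁰ N) =
      (Ideal.relNorm (𝓞 K) J : FractionalIdeal (𝓞 K)⁰ K) := by
  have h := DPF.relNorm_num_mul K N (J : FractionalIdeal (𝓞 N)⁰ N) J 1 (by simp)
  rw [map_one, mul_one] at h
  change (Ideal.relNorm (𝓞 K) (J : FractionalIdeal (𝓞 N)⁰ N).num : FractionalIdeal (𝓞 K)⁰ K) /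
    _ = _
  rw [div_eq_iff (DPF.relNorm_den_ne_zero K N _), h, FractionalIdeal.coeIdeal_mul]

theorem idealNorm_toPrincipalIdeal (x : Nˣ) :
    DPF.idealNorm K N (toPrincipalIdeal (𝓞 N) N x) =
      toPrincipalIdeal (𝓞 K) K (unitsNorm K N x) := by
  have key : ∀ a : 𝓞 N, DPF.fracRelNorm K N (FractionalIdeal.spanSingleton (𝓞 N)⁰ (a : N)) =
      FractionalIdeal.spanSingleton (𝓞 K)⁰ (Algebra.norm K (a : N)) := fun a => by
    rw [← FractionalIdeal.coeIdeal_span_singleton, fracRelNorm_coeIdeal, Ideal.relNorm_singleton,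
      FractionalIdeal.coeIdeal_span_singleton, Algebra.algebraMap_intNorm (A := 𝓞 K) (K := K)
        (L := N) (B := 𝓞 N)]
  symm
  rw [toPrincipalIdeal_eq_iff]
  change _ = DPF.fracRelNorm K N (toPrincipalIdeal (𝓞 N) N x : FractionalIdeal (𝓞 N)⁰ N)
  rw [coe_toPrincipalIdeal]
  obtain ⟨a, b, hb, hx⟩ := IsFractionRing.div_surjective (A := 𝓞 N) (x : N)
  have hb0 : (b : N) ≠ 0 := by
    simpa using nonZeroDivisors.ne_zero hb
  change FractionalIdeal.spanSingleton (𝓞 K)⁰ (Algebra.norm K (x : N)) = _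
  rw [← hx, div_eq_mul_inv, map_mul, Algebra.norm_inv,
    ← FractionalIdeal.spanSingleton_mul_spanSingleton,
    ← FractionalIdeal.spanSingleton_mul_spanSingleton, ← FractionalIdeal.spanSingleton_inv,
    ← FractionalIdeal.spanSingleton_inv, map_mul, map_inv₀, key, key]

theorem idealNorm_extend (I : DPF.FracIdeals K) :
    DPF.idealNorm K N (DPF.extend K N I) = I ^ finrank K N := by
  have : (DPF.idealNorm K N).comp (DPF.extend K N) = powMonoidHom (finrank K N) := by
    apply fracIdeals_hom_ext
    intro x
    rw [MonoidHom.comp_apply, extend_toPrincipalIdeal, idealNorm_toPrincipalIdeal,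
      powMonoidHom_apply, ← map_pow]
    congr 1
    exact Units.ext (by simp [unitsNorm, Algebra.norm_algebraMap])
  exact DFunLike.congr_fun this I

/-- All ideals of `ℚ` are principal. -/
theorem idealsFrom_rat (L : Type*) [Field L] [NumberField L] :
    DPF.idealsFrom ℚ L = DPF.principalFrom ℚ L := by
  have : DPF.principal ℚ = ⊤ := by
    rw [← classGroup_mk_ker, eq_top_iff]
    intro I _
    have : IsPrincipalIdealRing (𝓞 ℚ) :=
      IsPrincipalIdealRing.of_surjective _ Rat.ringOfIntegersEquiv.symm.surjective
    exact ClassGroup.mk_eq_one_iff.2 (I : FractionalIdeal (𝓞 ℚ)⁰ ℚ).isPrincipal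
  rw [DPF.idealsFrom, DPF.principalFrom, this, MonoidHom.range_eq_map]

theorem extend_extend (F M : Type*) [Field F] [NumberField F] [Field M] [NumberField M]
    [Algebra F K] [Algebra F M] [Algebra M N] [Algebra F N] [IsScalarTower F K N]
    [IsScalarTower F M N] (I : DPF.FracIdeals F) :
    DPF.extend K N (DPF.extend F K I) = DPF.extend M N (DPF.extend F M I) := by
  have : (DPF.extend K N).comp (DPF.extend F K) = (DPF.extend M N).comp (DPF.extend F M) := by
    apply fracIdeals_hom_ext
    intro x
    simp only [MonoidHom.comp_apply, extend_toPrincipalIdeal]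
    congr 1
    exact Units.ext (by simp [← IsScalarTower.algebraMap_apply])
  exact DFunLike.congr_fun this I

/-- Homomorphisms on fractional ideals that agree on principal ideals and on nonzero integral ideals
are equal. -/
theorem fracIdeals_hom_ext_of_integral {G : Type*} [Group G] {f g : DPF.FracIdeals K →* G}
    (h : ∀ x : Kˣ, f (toPrincipalIdeal (𝓞 K) K x) = g (toPrincipalIdeal (𝓞 K) K x))
    (h' : ∀ J : (Ideal (𝓞 K))⁰, f (FractionalIdeal.mk0 K J) = g (FractionalIdeal.mk0 K J)) :
    f = g := by
  ext1 I
  set J := (I : FractionalIdeal (𝓞 K)⁰ K).num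
  have hd : algebraMap (𝓞 K) K (I : FractionalIdeal (𝓞 K)⁰ K).den ≠ 0 := by
    simp
  have hJ : J ∈ (Ideal (𝓞 K))⁰ := by
    rw [mem_nonZeroDivisors_iff_ne_zero, Ne, FractionalIdeal.num_eq_zero_iff]
    exact I.ne_zero
  have hI : toPrincipalIdeal (𝓞 K) K (Units.mk0 _ hd) * I = FractionalIdeal.mk0 K ⟨J, hJ⟩ := by
    ext1
    rw [Units.val_mul, coe_toPrincipalIdeal, FractionalIdeal.coe_mk0]
    exact (I : FractionalIdeal (𝓞 K)⁰ K).den_mul_self_eq_num'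
  have h1 := h' ⟨J, hJ⟩
  rw [← hI, map_mul, map_mul, h] at h1
  exact mul_left_cancel h1

theorem extendedHom_classGroup_mk (I : DPF.FracIdeals K) :
    ClassGroup.extendedHom (𝓞 K) (𝓞 N) (ClassGroup.mk K I) =
      ClassGroup.mk N (DPF.extend K N I) := by
  have : (ClassGroup.extendedHom (𝓞 K) (𝓞 N)).comp (ClassGroup.mk K) =
      (ClassGroup.mk (R := 𝓞 N) N).comp (DPF.extend K N) := by
    apply fracIdeals_hom_ext_of_integral
    · intro x
      have h1 : ClassGroup.mk K (toPrincipalIdeal (𝓞 K) K x) = 1 := by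
        rw [← MonoidHom.mem_ker, classGroup_mk_ker]; exact ⟨x, rfl⟩
      rw [MonoidHom.comp_apply, MonoidHom.comp_apply, h1, map_one, eq_comm, ← MonoidHom.mem_ker,
        classGroup_mk_ker, extend_toPrincipalIdeal]
      exact ⟨_, rfl⟩
    · intro J
      rw [MonoidHom.comp_apply, MonoidHom.comp_apply, ClassGroup.mk_mk0,
        ClassGroup.extendedHom_mk0, ← ClassGroup.mk_mk0 N]
      congr 1
      ext1
      exact (FractionalIdeal.extendedHom_coeIdeal_eq_map (L := N) (B := 𝓞 N) _).symm
  exact DFunLike.congr_fun this I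

theorem capitulationKer_comap :
    (DPF.capitulationKer K N).comap (ClassGroup.mk K : DPF.FracIdeals K →* ClassGroup (𝓞 K)) =
      (DPF.principal N).comap (DPF.extend K N) := by
  ext I
  rw [Subgroup.mem_comap, Subgroup.mem_comap, DPF.capitulationKer, MonoidHom.mem_ker,
    extendedHom_classGroup_mk, ← MonoidHom.mem_ker, classGroup_mk_ker]

theorem classGroup_mk_surjective : Function.Surjective (ClassGroup.mk K :
    DPF.FracIdeals K →* ClassGroup (𝓞 K)) := fun c => by
  obtain ⟨J, rfl⟩ := ClassGroup.mk0_surjective c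
  exact ⟨_, ClassGroup.mk_mk0 K J⟩

end Ideals

/-! ### Ambiguous principal ideals -/

section Ambiguous

variable {K N : Type*} [Field K] [Field N] [NumberField K] [NumberField N] [Algebra K N]

omit [NumberField K] in
theorem map_mem_ker_toPrincipalIdeal (τ : Gal(N/K)) {u : Nˣ}
    (hu : u ∈ (toPrincipalIdeal (𝓞 N) N).ker) :
    Units.map (τ : N →* N) u ∈ (toPrincipalIdeal (𝓞 N) N).ker := by
  rw [← range_unitsIncl] at hu ⊢
  obtain ⟨v, rfl⟩ := hu
  exact ⟨Units.map (RingOfIntegers.mapRingEquiv (τ : N ≃+* N) : 𝓞 N →* 𝓞 N) v, Units.ext rfl⟩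

omit [NumberField K] in
theorem coboundary_mem_ker (σ : Gal(N/K)) {u : Nˣ} (hu : u ∈ (toPrincipalIdeal (𝓞 N) N).ker) :
    coboundary σ u ∈ (toPrincipalIdeal (𝓞 N) N).ker :=
  div_mem (map_mem_ker_toPrincipalIdeal σ hu) hu

/-- If `σ x / x` is a unit, where `σ` generates the Galois group, then `(x) ^ p` is generated by the
norm of `x`. -/
theorem toPrincipalIdeal_pow_eq {p : ℕ} [IsGalois K N] (hNK : finrank K N = p)
    {σ : Gal(N/K)} (hσ : ∀ τ, τ ∈ Subgroup.zpowers σ) {x : Nˣ}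
    (hx : coboundary σ x ∈ (toPrincipalIdeal (𝓞 N) N).ker) :
    toPrincipalIdeal (𝓞 N) N x ^ p =
      DPF.extend K N (toPrincipalIdeal (𝓞 K) K (unitsNorm K N x)) := by
  have h1 : ∀ i : ℕ, toPrincipalIdeal (𝓞 N) N (Units.map ((σ ^ i : Gal(N/K)) : N →* N) x) =
      toPrincipalIdeal (𝓞 N) N x := by
    intro i
    induction i with
    | zero => congr 1
    | succ i ih =>
      have h2 : Units.map ((σ ^ (i + 1) : Gal(N/K)) : N →* N) x =
          Units.map ((σ ^ i : Gal(N/K)) : N →* N) (coboundary σ x) *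
            Units.map ((σ ^ i : Gal(N/K)) : N →* N) x := by
        rw [← map_mul, coboundary, MonoidHom.div_apply, MonoidHom.id_apply, div_mul_cancel]
        exact Units.ext (by rw [pow_succ]; rfl)
      rw [h2, map_mul, MonoidHom.mem_ker.1 (map_mem_ker_toPrincipalIdeal (σ ^ i) hx), one_mul, ih]
  have h3 : Units.map (algebraMap K N : K →* N) (unitsNorm K N x) =
      ∏ i ∈ Finset.range p, Units.map ((σ ^ i : Gal(N/K)) : N →* N) x :=
    Units.ext (by
      rw [Units.coe_prod]
      exact algebraMap_norm_eq_prod_range hNK hσ x)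
  rw [extend_toPrincipalIdeal, h3, map_prod, Finset.prod_congr rfl fun i _ => h1 i,
    Finset.prod_const, Finset.card_range]

/-- A principal ideal `(x)` is ambiguous if and only if `σ x / x` is a unit. -/
theorem ambiguousPrincipal_eq_map {p : ℕ} (hp : p ≠ 0) [IsGalois K N] (hNK : finrank K N = p)
    {σ : Gal(N/K)} (hσ : ∀ τ, τ ∈ Subgroup.zpowers σ) :
    DPF.ambiguousPrincipal p K N =
      ((toPrincipalIdeal (𝓞 N) N).ker.comap (coboundary σ)).map (toPrincipalIdeal (𝓞 N) N) := by
  ext I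
  constructor
  · rintro ⟨⟨J, hJ⟩, ⟨x, rfl⟩⟩
    refine ⟨x, ?_, rfl⟩
    -- `x ^ (p h)` is an element of `K` times a unit for some `h ≠ 0`, so `(σ x / x) ^ (p h)` is a unit
    obtain ⟨h, hh, hprin⟩ := exists_pow_mem_principal K
    obtain ⟨b, hb⟩ := hprin J
    have h1 : toPrincipalIdeal (𝓞 N) N (x ^ (p * h)) =
        toPrincipalIdeal (𝓞 N) N (Units.map (algebraMap K N : K →* N) b) := by
      rw [← extend_toPrincipalIdeal, hb, map_pow, map_pow, hJ, powMonoidHom_apply, pow_mul]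
    have h2 := coboundary_mem_ker σ (MonoidHom.div_mem_ker_iff _ |>.2 h1)
    have h3 : coboundary σ (Units.map (algebraMap K N : K →* N) b) = 1 := by
      rw [coboundary, MonoidHom.div_apply, div_eq_one]
      exact Units.ext (σ.commutes _)
    rw [map_div, h3, div_one, MonoidHom.mem_ker, map_pow, map_pow] at h2
    exact fracIdeals_pow_injective (mul_ne_zero hp hh) (by simpa using h2)
  · rintro ⟨x, hx, rfl⟩
    exact ⟨⟨_, (toPrincipalIdeal_pow_eq hNK hσ hx).symm⟩, ⟨x, rfl⟩⟩

theorem ker_coboundary [IsGalois K N] {σ : Gal(N/K)} (hσ : ∀ τ, τ ∈ Subgroup.zpowers σ) :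
    (coboundary σ).ker = (Units.map (algebraMap K N : K →* N)).range := by
  ext x
  rw [MonoidHom.mem_ker, coboundary, MonoidHom.div_apply, div_eq_one]
  constructor
  · intro h
    obtain ⟨y, hy⟩ := mem_range_algebraMap_of_generator hσ (congrArg Units.val h)
    have hy0 : y ≠ 0 := by rintro rfl; exact x.ne_zero (by rw [← hy, map_zero])
    exact ⟨Units.mk0 y hy0, Units.ext hy⟩
  · rintro ⟨y, rfl⟩
    exact Units.ext (σ.commutes _)

/-- **Hilbert's Theorem 90** for a cyclic extension. -/
theorem exists_coboundary_eq [IsGalois K N] {σ : Gal(N/K)} (hσ : ∀ τ, τ ∈ Subgroup.zpowers σ)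
    {a : Nˣ} (ha : unitsNorm K N a = 1) : ∃ x, coboundary σ x = a := by
  set n := finrank K N with hn
  have ho : orderOf σ = n := by
    rw [orderOf_eq_card_of_forall_mem_zpowers hσ, IsGalois.card_aut_eq_finrank]
  set P : ℕ → N := fun i => ∏ j ∈ Finset.range i, (σ ^ j) (a : N) with hP
  have hPsucc : ∀ i, P (i + 1) = a * σ (P i) := fun i => by
    simp only [hP, Finset.prod_range_succ', map_prod, pow_zero, AlgEquiv.one_apply, pow_succ',
      AlgEquiv.mul_apply]
    rw [mul_comm]
  have hPn : P n = P 0 := by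
    have h1 := algebraMap_norm_eq_prod_range hn.symm hσ (a : N)
    rw [show Algebra.norm K (a : N) = 1 from congrArg Units.val ha, map_one] at h1
    simp only [hP, ← h1, Finset.range_zero, Finset.prod_empty]
  -- the characters `σ ^ i` are linearly independent
  obtain ⟨z, hz⟩ : ∃ z : N, ∑ i ∈ Finset.range n, P i * (σ ^ i) z ≠ 0 := by
    by_contra! h
    have hinj : Function.Injective fun i : Fin n => ((σ ^ (i : ℕ) : Gal(N/K)) : N →* N) := by
      intro i j hij
      apply Fin.ext
      apply pow_injOn_Iio_orderOf (x := σ) (by simp [ho]) (by simp [ho])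
      ext x
      exact DFunLike.congr_fun hij x
    have hind := (linearIndependent_monoidHom N N).comp _ hinj
    rw [Fintype.linearIndependent_iff] at hind
    have h0 := hind (fun i => P i) (by
      ext x
      rw [Finset.sum_apply, Pi.zero_apply, ← h x, Finset.sum_range]
      rfl) ⟨0, finrank_pos⟩
    simp [hP] at h0
  -- Lagrange resolvent
  set β := ∑ i ∈ Finset.range n, P i * (σ ^ i) z with hβ
  have h1 : a * σ β = β := by
    have h2 : a * σ β = ∑ i ∈ Finset.range n, P (i + 1) * (σ ^ (i + 1)) z := by
      rw [hβ, map_sum, Finset.mul_sum]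
      refine Finset.sum_congr rfl fun i _ => ?_
      rw [hPsucc, map_mul, pow_succ', AlgEquiv.mul_apply, mul_assoc]
    have h3 := Finset.sum_range_succ' (fun i => P i * (σ ^ i) z) n
    rw [Finset.sum_range_succ, hPn, ← ho, pow_orderOf_eq_one, ho, pow_zero] at h3
    rw [h2, ← add_right_cancel h3]
  refine ⟨(Units.mk0 β hz)⁻¹, ?_⟩
  rw [map_inv, coboundary, MonoidHom.div_apply, inv_div, div_eq_iff_eq_mul]
  exact Units.ext h1.symm

/-- By Hilbert's Theorem 90, the units of the form `σ x / x` are the units of norm `1`. -/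
theorem map_coboundary_eq [IsGalois K N] {σ : Gal(N/K)} (hσ : ∀ τ, τ ∈ Subgroup.zpowers σ) :
    ((toPrincipalIdeal (𝓞 N) N).ker.comap (coboundary σ)).map (coboundary σ) =
      (toPrincipalIdeal (𝓞 N) N).ker ⊓ (unitsNorm K N).ker := by
  rw [Subgroup.map_comap_eq, inf_comm]
  congr 1
  ext y
  constructor
  · rintro ⟨x, rfl⟩
    rw [MonoidHom.mem_ker, coboundary, MonoidHom.div_apply, map_div, div_eq_one]
    exact Units.ext (Algebra.norm_eq_of_algEquiv σ _)
  · intro hy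
    exact exists_coboundary_eq hσ hy

/-- `P_{N/K} / P_K` and `H⁻¹` of the units of `N` have the same order: both are isomorphic to the
group of all `x` with `σ x / x` a unit, modulo `Kˣ U_N`. -/
theorem relIndex_principalFrom {p : ℕ} (hp : p ≠ 0) [IsGalois K N] (hNK : finrank K N = p)
    {σ : Gal(N/K)} (hσ : ∀ τ, τ ∈ Subgroup.zpowers σ) :
    (DPF.principalFrom K N).relIndex (DPF.ambiguousPrincipal p K N) =
      ((toPrincipalIdeal (𝓞 N) N).ker.map (coboundary σ)).relIndex
        ((toPrincipalIdeal (𝓞 N) N).ker ⊓ (unitsNorm K N).ker) := by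
  have h1 : DPF.principalFrom K N =
      (Units.map (algebraMap K N : K →* N)).range.map (toPrincipalIdeal (𝓞 N) N) := by
    rw [DPF.principalFrom, DPF.principal, MonoidHom.map_range, MonoidHom.map_range]
    congr 1
    ext1 x
    exact extend_toPrincipalIdeal x
  have h2 : (toPrincipalIdeal (𝓞 N) N).ker ≤
      (toPrincipalIdeal (𝓞 N) N).ker.comap (coboundary σ) := fun u hu => coboundary_mem_ker σ hu
  have h3 : (coboundary σ).ker ≤ (toPrincipalIdeal (𝓞 N) N).ker.comap (coboundary σ) :=
    fun u hu => by rw [Subgroup.mem_comap, MonoidHom.mem_ker.1 hu]; exact one_mem _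
  rw [ambiguousPrincipal_eq_map hp hNK hσ, h1, Subgroup.relIndex_map_map, ← map_coboundary_eq hσ,
    Subgroup.relIndex_map_map, sup_eq_left.2 h2, sup_eq_left.2 h3, ker_coboundary hσ, sup_comm]

/-- `P_{N/K} / P_K` has order `p ^ (U + 1)`, where `p ^ U` is the unit norm index. -/
theorem exists_relIndex_principalFrom {p : ℕ} [Fact p.Prime] (hp : Odd p) [IsGalois K N]
    [IsCyclic Gal(N/K)] (hNK : finrank K N = p) :
    ∃ U : ℕ, (DPF.unitNorms K N).index = p ^ U ∧
      (DPF.principalFrom K N).relIndex (DPF.ambiguousPrincipal p K N) = p ^ (U + 1) := by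
  obtain ⟨σ, hσ⟩ := IsCyclic.exists_generator (α := Gal(N/K))
  rw [relIndex_principalFrom (Fact.out : p.Prime).ne_zero hNK hσ]
  exact exists_index_unitNorms hp hNK hσ

/-- `(P_{N/K} ∩ I_K) / P_K` has the order of the capitulation kernel. -/
theorem relIndex_eq_card_capitulationKer {p : ℕ} :
    (DPF.principalFrom K N).relIndex (DPF.idealsFrom K N ⊓ DPF.ambiguousPrincipal p K N) =
      Nat.card (DPF.capitulationKer K N) := by
  have h1 : DPF.idealsFrom K N ⊓ DPF.ambiguousPrincipal p K N =
      ((DPF.principal N).comap (DPF.extend K N)).map (DPF.extend K N) := by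
    rw [Subgroup.map_comap_eq, DPF.ambiguousPrincipal, ← inf_assoc, DPF.idealsFrom]
    congr 1
    exact inf_eq_left.2 fun I hI => pow_mem hI p
  rw [h1, DPF.principalFrom, Subgroup.relIndex_map_map_of_injective _ _ extend_injective,
    ← classGroup_mk_ker, Subgroup.relIndex_ker, ← capitulationKer_comap,
    Subgroup.map_comap_eq_self_of_surjective classGroup_mk_surjective]

/-- If `I` becomes principal in `N`, then its `[N : K]`-th power is the norm of a principal ideal. -/
theorem capitulationKer_pow (c : DPF.capitulationKer K N) : c ^ finrank K N = 1 := by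
  obtain ⟨c, hc⟩ := c
  obtain ⟨I, rfl⟩ := classGroup_mk_surjective c
  have h1 : I ∈ (DPF.principal N).comap (DPF.extend K N) := by
    rw [← capitulationKer_comap]; exact hc
  obtain ⟨x, hx⟩ := h1
  apply Subtype.ext
  change ClassGroup.mk K I ^ finrank K N = 1
  rw [← map_pow, ← idealNorm_extend (N := N), ← hx, idealNorm_toPrincipalIdeal,
    ← MonoidHom.mem_ker, classGroup_mk_ker]
  exact ⟨_, rfl⟩

end Ambiguous

/-! ### The norm to `L` and the fundamental equation -/

section Main

variable {N : Type*} [Field N] [NumberField N] {K L : IntermediateField ℚ N}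

/-- For linearly disjoint `L` and `K` with compositum `N`, the norm `N_{N/L}` of an ideal of `K` is
the extension to `L` of its norm to `ℚ`. -/
theorem idealNorm_extend_eq (h : L.LinearDisjoint K) (hsup : L ⊔ K = ⊤) (I : DPF.FracIdeals K) :
    DPF.idealNorm L N (DPF.extend K N I) = DPF.extend ℚ L (DPF.idealNorm ℚ K I) := by
  have : (DPF.idealNorm L N).comp (DPF.extend K N) =
      (DPF.extend ℚ L).comp (DPF.idealNorm ℚ K) := by
    apply fracIdeals_hom_ext
    intro x
    rw [MonoidHom.comp_apply, MonoidHom.comp_apply, extend_toPrincipalIdeal,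
      idealNorm_toPrincipalIdeal, idealNorm_toPrincipalIdeal, extend_toPrincipalIdeal]
    congr 1
    exact Units.ext (h.norm_algebraMap hsup (x : K))
  exact DFunLike.congr_fun this I

theorem extend_mem_ambiguousPrincipal {p : ℕ} {I : DPF.FracIdeals L}
    (hI : I ∈ DPF.ambiguousPrincipal p ℚ L) :
    DPF.extend L N I ∈ DPF.ambiguousPrincipal p K N := by
  obtain ⟨⟨J, hJ⟩, ⟨x, rfl⟩⟩ := hI
  refine ⟨⟨DPF.extend ℚ K J, ?_⟩, ?_⟩
  · rw [extend_extend (N := N) ℚ L, hJ, powMonoidHom_apply, powMonoidHom_apply, map_pow]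
  · rw [extend_toPrincipalIdeal]; exact ⟨_, rfl⟩

theorem idealNorm_mem_ambiguousPrincipal {p : ℕ} (h : L.LinearDisjoint K) (hsup : L ⊔ K = ⊤)
    {I : DPF.FracIdeals N} (hI : I ∈ DPF.ambiguousPrincipal p K N) :
    DPF.idealNorm L N I ∈ DPF.ambiguousPrincipal p ℚ L := by
  obtain ⟨⟨J, hJ⟩, ⟨x, rfl⟩⟩ := hI
  refine ⟨⟨DPF.idealNorm ℚ K J, ?_⟩, ?_⟩
  · rw [← idealNorm_extend_eq h hsup, hJ, powMonoidHom_apply, powMonoidHom_apply, map_pow]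
  · rw [idealNorm_toPrincipalIdeal]; exact ⟨_, rfl⟩

/-- Modulo `I_ℚ`, the norm maps `P_{N/K}` onto `P_{L/ℚ}`. -/
theorem idealsFrom_sup_map_idealNorm {p : ℕ} (h : L.LinearDisjoint K) (hsup : L ⊔ K = ⊤)
    (hNL : Nat.Coprime (finrank L N) p) :
    (DPF.ambiguousPrincipal p K N).map (DPF.idealNorm L N) ⊔ DPF.idealsFrom ℚ L =
      DPF.ambiguousPrincipal p ℚ L ⊔ DPF.idealsFrom ℚ L := by
  apply le_antisymm
  · refine sup_le_sup_right ?_ _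
    rintro _ ⟨I, hI, rfl⟩
    exact idealNorm_mem_ambiguousPrincipal h hsup hI
  · refine sup_le (fun I hI => ?_) le_sup_right
    set m := finrank L N
    -- Bézout for `m` and `p`; `I ^ m` is the norm of `I 𝓞_N`, and `I ^ p` comes from `ℚ`
    have h1 : I = (I ^ m) ^ (Nat.gcdA m p) * (I ^ p) ^ (Nat.gcdB m p) := by
      have h2 := Nat.gcd_eq_gcd_ab m p
      rw [hNL.gcd_eq_one, Nat.cast_one] at h2
      rw [← zpow_natCast, ← zpow_natCast, ← zpow_mul, ← zpow_mul, ← zpow_add, ← h2, zpow_one]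
    rw [h1]
    refine mul_mem (zpow_mem (Subgroup.mem_sup_left ?_) _) (zpow_mem (Subgroup.mem_sup_right ?_) _)
    · exact ⟨DPF.extend L N I, extend_mem_ambiguousPrincipal hI, idealNorm_extend I⟩
    · exact hI.1

/-- A class of `P_{N/K} I_K / I_K` in the kernel of the norm is represented by an ideal of `P_{N/K}`
whose norm lies in `I_ℚ`, because norms of ideals of `K` do. -/
theorem relFactors_eq_map {p : ℕ} (h : L.LinearDisjoint K) (hsup : L ⊔ K = ⊤) :
    DPF.relFactors p ℚ K L N =
      (DPF.ambiguousPrincipal p K N ⊓ (DPF.idealsFrom ℚ L).comap (DPF.idealNorm L N)).map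
        (QuotientGroup.mk' (DPF.idealsFrom K N)) := by
  apply le_antisymm
  · rintro _ ⟨⟨A, ⟨hA, hA'⟩, rfl⟩, ⟨B, hB, hAB⟩⟩
    refine ⟨B, ⟨hB, ?_⟩, hAB⟩
    obtain ⟨J, hJ⟩ := QuotientGroup.eq.1 hAB.symm
    have h1 : B = A * DPF.extend K N J := by rw [hJ]; simp
    change DPF.idealNorm L N _ ∈ DPF.idealsFrom ℚ L at hA' ⊢
    rw [h1, map_mul, idealNorm_extend_eq h hsup]
    exact mul_mem hA' ⟨_, rfl⟩
  · rintro _ ⟨A, ⟨hA, hA'⟩, rfl⟩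
    exact ⟨⟨A, ⟨hA.1, hA'⟩, rfl⟩, ⟨A, hA, rfl⟩⟩

/-- `P_{N/K} I_K / I_K` is an extension of the absolute factors of `L` by the relative factors. -/
theorem card_relFactors_mul_card_absFactors {p : ℕ} (h : L.LinearDisjoint K) (hsup : L ⊔ K = ⊤)
    (hNL : Nat.Coprime (finrank L N) p) :
    Nat.card (DPF.relFactors p ℚ K L N) * Nat.card (DPF.AbsFactors p ℚ L) =
      (DPF.idealsFrom K N).relIndex (DPF.ambiguousPrincipal p K N) := by
  set P := DPF.ambiguousPrincipal p K N
  set Q := P ⊓ (DPF.idealsFrom ℚ L).comap (DPF.idealNorm L N)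
  have h1 : Nat.card (DPF.relFactors p ℚ K L N) = (DPF.idealsFrom K N).relIndex Q := by
    rw [relFactors_eq_map h hsup, ← Subgroup.relIndex_ker, QuotientGroup.ker_mk']
  have h2 : Nat.card (DPF.AbsFactors p ℚ L) = Q.relIndex P := by
    rw [Subgroup.inf_relIndex_left, Subgroup.relIndex_comap, ← Subgroup.relIndex_sup_right,
      idealsFrom_sup_map_idealNorm h hsup hNL, Subgroup.relIndex_sup_right, idealsFrom_rat]
    rfl
  have h3 : DPF.idealsFrom K N ⊓ P ≤ Q := by
    rintro _ ⟨⟨J, rfl⟩, hI⟩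
    refine ⟨hI, ?_⟩
    change DPF.idealNorm L N _ ∈ DPF.idealsFrom ℚ L
    rw [idealNorm_extend_eq h hsup]
    exact ⟨_, rfl⟩
  have h4 : DPF.idealsFrom K N ⊓ Q = DPF.idealsFrom K N ⊓ P :=
    le_antisymm (inf_le_inf_left _ inf_le_left) (le_inf inf_le_left h3)
  rw [h1, h2, ← Subgroup.inf_relIndex_right, h4, Subgroup.relIndex_mul_relIndex _ _ _ h3 inf_le_left,
    Subgroup.inf_relIndex_right]

end Main

theorem corollary4p1 (p : ℕ) [Fact p.Prime] (hp : p ≠ 2)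
    {N : Type*} [Field N] [NumberField N] (K L : IntermediateField ℚ N)
    (hsup : K ⊔ L = ⊤) (hinf : K ⊓ L = ⊥)
    (hL : Module.finrank ℚ L = p) (hNL : Nat.Coprime (Module.finrank L N) p)
    (hNK : Module.finrank K N = p) [IsGalois K N] [IsCyclic Gal(N/K)] :
    ∃ U A R C : ℕ,
      (DPF.unitNorms K N).index = p ^ U ∧
      DPF.HasDim p (DPF.AbsFactors p ℚ L) A ∧
      DPF.HasDim p (DPF.relFactors p ℚ K L N) R ∧
      DPF.HasDim p (DPF.capitulationKer K N) C ∧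
      U + 1 = A + R + C := by
  have hpp : p.Prime := Fact.out
  have hsup' : L ⊔ K = ⊤ := by rwa [sup_comm]
  have hdisj : L.LinearDisjoint K := by
    apply IntermediateField.LinearDisjoint.of_finrank_sup
    rw [hsup', IntermediateField.finrank_top', ← finrank_mul_finrank ℚ K N, hNK, hL, mul_comm]
  obtain ⟨U, hU, hPU⟩ := exists_relIndex_principalFrom (K := K) (N := N) (p := p)
    (hpp.odd_of_ne_two hp) hNK
  have hle : DPF.principalFrom K N ⊓ DPF.idealsFrom K N = DPF.principalFrom K N :=
    inf_eq_left.2 (by rintro _ ⟨I, -, rfl⟩; exact ⟨I, rfl⟩)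
  rw [← hle, ← Subgroup.relIndex_inf_mul_relIndex, relIndex_eq_card_capitulationKer,
    ← card_relFactors_mul_card_absFactors hdisj hsup' hNL] at hPU
  have hdvd : ∀ {n : ℕ}, n ∣ p ^ (U + 1) → ∃ d, n = p ^ d := fun hn => by
    obtain ⟨d, -, hd⟩ := (Nat.dvd_prime_pow hpp).1 hn
    exact ⟨d, hd⟩
  obtain ⟨C, hC⟩ := hdvd (hPU ▸ Dvd.intro _ rfl)
  obtain ⟨R, hR⟩ := hdvd (hPU ▸ (Dvd.intro _ rfl : _ ∣ _ * _).mul_left _)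
  obtain ⟨A, hA⟩ := hdvd (hPU ▸ (Dvd.intro_left _ rfl : _ ∣ _ * _).mul_left _)
  refine ⟨U, A, R, C, hU, hasDim_of_card p ?_ hA, hasDim_of_card p ?_ hR,
    hasDim_of_card p ?_ hC, ?_⟩
  · intro x
    obtain ⟨⟨I, hI⟩, rfl⟩ := QuotientGroup.mk_surjective x
    rw [← QuotientGroup.mk_pow, QuotientGroup.eq_one_iff, Subgroup.mem_subgroupOf,
      ← idealsFrom_rat]
    exact hI.1
  · rintro ⟨_, ⟨⟨I, hI, rfl⟩, -⟩⟩
    apply Subtype.ext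
    change QuotientGroup.mk' (DPF.idealsFrom K N) I ^ p = 1
    rw [← map_pow, ← MonoidHom.mem_ker, QuotientGroup.ker_mk']
    exact hI.1
  · intro c
    rw [← hNK]
    exact capitulationKer_pow c
  · rw [hC, hR, hA, ← pow_add, ← pow_add] at hPU
    have := Nat.pow_right_injective hpp.two_le hPU
    omega
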